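/- Let $n\ge 2$, let $\mathbb F_{n-1}$ be the free group on $n-1$ generators, let $w_2,\dots,w_n$ be the universal unitaries that generate the full group C$^*$-algebra $C^*(\mathbb F_{n-1})$, and let $w_1=1$. Let $\mathcal W_n\subseteq C^*(\mathbb F_{n-1})$ be the operator system spanned by $\{w_iw_j^* : 1\le i,j\le n\}$, and let $\mathcal E_n\subseteq M_n(\mathbb C)$ be the operator subsystem $$\mathcal E_n=\{A=[a_{ij}]\in M_n(\mathbb C) : a_{ii}=a_{jj},\ 1\le i,j\le n\}.$$ Let $\mathcal W_n^d$ denote the dual vector space of $\mathcal W_n$ with the involution $f^*(s)=\overline{f(s^*)}$, where a matrix $G=[g_{ij}]\in M_p(\mathcal W_n^d)$ is positive if and only if the map $\mathcal W_n\to M_p(\mathbb C)$, $s\mapsto[g_{ij}(s)]$, is completely positive. A faithful state $\delta$ on $\mathcal W_n$ exists, and with any faithful state $\delta$ as Archimedean order unit $\mathcal W_n^d$ is an operator system. The operator systems $\mathcal W_n^d$ and $\mathcal E_n$ are completely order isomorphic: there is a linear isomorphism $\theta:\mathcal W_n^d\to\mathcal E_n$ such that $\theta$ and $\theta^{-1}$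 are completely positive. -/

import Mathlib

open scoped ComplexOrder ENNReal Matrix

/-- The matrix `α* x α` for a scalar matrix `α` and a matrix `x` over a complex vector space. -/
def scalarCompress {V : Type*} [AddCommGroup V] [Module ℂ V] {p q : ℕ}
    (α : Matrix (Fin p) (Fin q) ℂ) (x : Matrix (Fin p) (Fin p) V) : Matrix (Fin q) (Fin q) V :=
  Matrix.of fun i j => ∑ k, ∑ l, (star (α k i) * α l j) • x k l

/-- An (abstract) operator system on a complex `*`-vector space `V`: a matrix ordering, given by
proper cones of hermitian matrices that are compatible under compression by scalar matrices,
together with an Archimedean matrix order unit. -/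
structure OperatorSystem (V : Type*) [AddCommGroup V] [Module ℂ V] [StarAddMonoid V]
    [StarModule ℂ V] where
  /-- the positive cone `M_p(V)_+` -/
  cone : ∀ p : ℕ, Set (Matrix (Fin p) (Fin p) V)
  /-- the order unit -/
  unit : V
  isHermitian : ∀ {p : ℕ} {x : Matrix (Fin p) (Fin p) V}, x ∈ cone p → xᴴ = x
  add_mem : ∀ {p : ℕ} {x y : Matrix (Fin p) (Fin p) V}, x ∈ cone p → y ∈ cone p → x + y ∈ cone p
  smul_mem : ∀ {p : ℕ} {x : Matrix (Fin p) (Fin p) V} (r : ℝ), 0 ≤ r → x ∈ cone p →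
    (r : ℂ) • x ∈ cone p
  proper : ∀ {p : ℕ} {x : Matrix (Fin p) (Fin p) V}, x ∈ cone p → -x ∈ cone p → x = 0
  compress_mem : ∀ {p q : ℕ} (α : Matrix (Fin p) (Fin q) ℂ) {x : Matrix (Fin p) (Fin p) V},
    x ∈ cone p → scalarCompress α x ∈ cone q
  star_unit : star unit = unit
  order_unit : ∀ {p : ℕ} (x : Matrix (Fin p) (Fin p) V), xᴴ = x →
    ∃ r : ℝ, 0 ≤ r ∧ (r : ℂ) • Matrix.diagonal (fun _ => unit) + x ∈ cone p
  archimedean : ∀ {p : ℕ} (x : Matrix (Fin p) (Fin p) V),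
    (∀ ε : ℝ, 0 < ε → (ε : ℂ) • Matrix.diagonal (fun _ => unit) + x ∈ cone p) → x ∈ cone p

/-- A linear map `φ` is completely positive if every amplification `φ^(p)`, applied entrywise,
maps `M_p(V)_+` into `M_p(W)_+`. -/
def IsCompletelyPositive {V W : Type*} [AddCommGroup V] [Module ℂ V] [StarAddMonoid V]
    [StarModule ℂ V] [AddCommGroup W] [Module ℂ W] [StarAddMonoid W] [StarModule ℂ W]
    (S : OperatorSystem V) (T : OperatorSystem W) (φ : V →ₗ[ℂ] W) : Prop :=
  ∀ (p : ℕ) (x : Matrix (Fin p) (Fin p) V), x ∈ S.cone p → x.map φ ∈ T.cone p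

/-- A complete order isomorphism: a linear isomorphism that is completely positive and has a
completely positive inverse. -/
def IsCompleteOrderIso {V W : Type*} [AddCommGroup V] [Module ℂ V] [StarAddMonoid V]
    [StarModule ℂ V] [AddCommGroup W] [Module ℂ W] [StarAddMonoid W] [StarModule ℂ W]
    (S : OperatorSystem V) (T : OperatorSystem W) (φ : V ≃ₗ[ℂ] W) : Prop :=
  IsCompletelyPositive S T φ.toLinearMap ∧ IsCompletelyPositive T S φ.symm.toLinearMap

/-- Two operator systems are completely order isomorphic. -/
def CompletelyOrderIsomorphic {V W : Type*} [AddCommGroup V] [Module ℂ V] [StarAddMonoid V]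
    [StarModule ℂ V] [AddCommGroup W] [Module ℂ W] [StarAddMonoid W] [StarModule ℂ W]
    (S : OperatorSystem V) (T : OperatorSystem W) : Prop :=
  ∃ φ : V ≃ₗ[ℂ] W, IsCompleteOrderIso S T φ

/-- The cone of positive elements of the C*-algebra `M_p(A)`. -/
def cstarCone (A : Type*) [CStarAlgebra A] (p : ℕ) : Set (Matrix (Fin p) (Fin p) A) :=
  {x | ∃ y : Matrix (Fin p) (Fin p) A, x = yᴴ * y}

theorem CStarAlgebra.nonneg_iff_star_mul {B : Type*} [CStarAlgebra B] [PartialOrder B]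
    [StarOrderedRing B] (b : B) : 0 ≤ b ↔ ∃ c, b = star c * c :=
  CStarAlgebra.nonneg_iff_eq_star_mul_self

theorem mem_cstarCone_iff {A : Type*} [CStarAlgebra A] [PartialOrder A] [StarOrderedRing A]
    {p : ℕ} (x : Matrix (Fin p) (Fin p) A) :
    x ∈ cstarCone A p ↔ 0 ≤ CStarMatrix.ofMatrix x := by
  exact (CStarAlgebra.nonneg_iff_star_mul (CStarMatrix.ofMatrix x)).symm

theorem cstarCone_add_mem {A : Type*} [CStarAlgebra A] {p : ℕ} {x y : Matrix (Fin p) (Fin p) A}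
    (hx : x ∈ cstarCone A p) (hy : y ∈ cstarCone A p) : x + y ∈ cstarCone A p := by
  let _ := CStarAlgebra.spectralOrder A
  let _ := CStarAlgebra.spectralOrderedRing A
  rw [mem_cstarCone_iff] at *
  exact add_nonneg hx hy

theorem cstarCone_proper {A : Type*} [CStarAlgebra A] {p : ℕ} {x : Matrix (Fin p) (Fin p) A}
    (hx : x ∈ cstarCone A p) (hy : -x ∈ cstarCone A p) : x = 0 := by
  let _ := CStarAlgebra.spectralOrder A
  let _ := CStarAlgebra.spectralOrderedRing A
  rw [mem_cstarCone_iff] at *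
  exact le_antisymm (α := CStarMatrix (Fin p) (Fin p) A) (neg_nonneg.mp hy) hx

theorem cstarCone_smul_mem {A : Type*} [CStarAlgebra A] {p : ℕ} {x : Matrix (Fin p) (Fin p) A}
    (r : ℝ) (hr : 0 ≤ r) (hx : x ∈ cstarCone A p) : (r : ℂ) • x ∈ cstarCone A p := by
  obtain ⟨y, rfl⟩ := hx
  refine ⟨((Real.sqrt r : ℝ) : ℂ) • y, ?_⟩
  rw [Matrix.conjTranspose_smul, Matrix.smul_mul, Matrix.mul_smul, smul_smul]
  congr 1
  rw [Complex.star_def, Complex.conj_ofReal, ← Complex.ofReal_mul, Real.mul_self_sqrt hr]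

theorem cstarCone_gram_mem {A : Type*} [CStarAlgebra A] {p q : ℕ}
    (z : Matrix (Fin p) (Fin q) A) : zᴴ * z ∈ cstarCone A q := by
  rcases Nat.eq_zero_or_pos q with rfl | hq
  · exact ⟨0, Subsingleton.elim _ _⟩
  have key : zᴴ * z = ∑ k : Fin p,
      (Matrix.of fun i j => if i = (⟨0, hq⟩ : Fin q) then z k j else 0)ᴴ *
      (Matrix.of fun (i j : Fin q) => if i = (⟨0, hq⟩ : Fin q) then z k j else 0) := by
    ext i j
    simp [Matrix.mul_apply, Matrix.sum_apply, apply_ite]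
  rw [key]
  refine Finset.sum_induction _ (· ∈ cstarCone A q) (fun _ _ => cstarCone_add_mem) ⟨0, by simp⟩ ?_
  intro k _
  exact ⟨_, rfl⟩

theorem cstarCone_compress_mem {A : Type*} [CStarAlgebra A] {p q : ℕ}
    (α : Matrix (Fin p) (Fin q) ℂ) {x : Matrix (Fin p) (Fin p) A} (hx : x ∈ cstarCone A p) :
    scalarCompress α x ∈ cstarCone A q := by
  obtain ⟨y, rfl⟩ := hx
  convert cstarCone_gram_mem (y * α.map (algebraMap ℂ A)) using 1
  rw [Matrix.conjTranspose_mul, Matrix.mul_assoc, ← Matrix.mul_assoc yᴴ]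
  generalize yᴴ * y = w
  ext i j
  simp only [scalarCompress, Matrix.of_apply, Matrix.mul_apply, Matrix.conjTranspose_apply,
    Matrix.map_apply, Finset.mul_sum]
  refine Finset.sum_congr rfl fun k _ => Finset.sum_congr rfl fun l _ => ?_
  rw [← algebraMap_star_comm, ← Algebra.commutes (α l j), ← mul_assoc, ← map_mul,
    Algebra.smul_def]

theorem cstarCone_order_unit {A : Type*} [CStarAlgebra A] {p : ℕ} (x : Matrix (Fin p) (Fin p) A)
    (hx : xᴴ = x) :
    ∃ r : ℝ, 0 ≤ r ∧ (r : ℂ) • Matrix.diagonal (fun _ => (1 : A)) + x ∈ cstarCone A p := by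
  let _ := CStarAlgebra.spectralOrder A
  let _ := CStarAlgebra.spectralOrderedRing A
  let X : CStarMatrix (Fin p) (Fin p) A := CStarMatrix.ofMatrix x
  have hX : IsSelfAdjoint X := hx
  refine ⟨‖X‖, norm_nonneg _, ?_⟩
  rw [mem_cstarCone_iff]
  have h := hX.neg_algebraMap_norm_le_self
  have h2 := neg_le_iff_add_nonneg.mp h
  rw [add_comm] at h2
  convert h2 using 1
  rw [Algebra.algebraMap_eq_smul_one]
  rfl

theorem cstarCone_archimedean {A : Type*} [CStarAlgebra A] {p : ℕ} (x : Matrix (Fin p) (Fin p) A)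
    (hx : ∀ ε : ℝ, 0 < ε → (ε : ℂ) • Matrix.diagonal (fun _ => (1 : A)) + x ∈ cstarCone A p) :
    x ∈ cstarCone A p := by
  let _ := CStarAlgebra.spectralOrder A
  let _ := CStarAlgebra.spectralOrderedRing A
  rw [mem_cstarCone_iff]
  let X : CStarMatrix (Fin p) (Fin p) A := CStarMatrix.ofMatrix x
  have h : Filter.Tendsto (fun ε : ℝ => (ε : ℂ) • (1 : CStarMatrix (Fin p) (Fin p) A) + X)
      (nhdsWithin 0 (Set.Ioi 0)) (nhds X) := by
    have : Continuous fun ε : ℝ => (ε : ℂ) • (1 : CStarMatrix (Fin p) (Fin p) A) + X := by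
      fun_prop
    have h0 := this.tendsto 0
    simp only [Complex.ofReal_zero, zero_smul, zero_add] at h0
    exact h0.mono_left nhdsWithin_le_nhds
  refine ge_of_tendsto h ?_
  filter_upwards [self_mem_nhdsWithin] with ε hε
  have := hx ε hε
  rw [mem_cstarCone_iff] at this
  exact this

theorem cstarCone_isHermitian {A : Type*} [CStarAlgebra A] {p : ℕ}
    {x : Matrix (Fin p) (Fin p) A} (hx : x ∈ cstarCone A p) : xᴴ = x := by
  obtain ⟨y, rfl⟩ := hx
  simp

/-- A unital C*-algebra as an operator system. -/
def OperatorSystem.ofCStarAlgebra (A : Type*) [CStarAlgebra A] : OperatorSystem A where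
  cone := cstarCone A
  unit := 1
  isHermitian := cstarCone_isHermitian
  add_mem := cstarCone_add_mem
  smul_mem := cstarCone_smul_mem
  proper := cstarCone_proper
  compress_mem := cstarCone_compress_mem
  star_unit := star_one A
  order_unit := cstarCone_order_unit
  archimedean := cstarCone_archimedean

/-- An operator subsystem of a unital C*-algebra `A`: a linear subspace that is closed under the
involution and contains the unit. -/
structure OperatorSubsystem (A : Type*) [CStarAlgebra A] extends Submodule ℂ A where
  one_mem' : (1 : A) ∈ carrier
  star_mem' : ∀ {a : A}, a ∈ carrier → star a ∈ carrier

instance OperatorSubsystem.instSetLike (A : Type*) [CStarAlgebra A] :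
    SetLike (OperatorSubsystem A) A where
  coe U := U.carrier
  coe_injective U U' h := by
    obtain ⟨U, _, _⟩ := U
    obtain ⟨U', _, _⟩ := U'
    congr
    exact SetLike.coe_injective h

instance OperatorSubsystem.instAddSubgroupClass (A : Type*) [CStarAlgebra A] :
    AddSubgroupClass (OperatorSubsystem A) A where
  add_mem {U} _ _ := U.toSubmodule.add_mem
  zero_mem U := U.toSubmodule.zero_mem
  neg_mem {U} _ := U.toSubmodule.neg_mem

instance OperatorSubsystem.instSMulMemClass (A : Type*) [CStarAlgebra A] :
    SMulMemClass (OperatorSubsystem A) ℂ A where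
  smul_mem {U} r _ := U.toSubmodule.smul_mem r

instance OperatorSubsystem.instStarMemClass (A : Type*) [CStarAlgebra A] :
    StarMemClass (OperatorSubsystem A) A where
  star_mem {U} _ := U.star_mem'

noncomputable instance OperatorSubsystem.instAddCommGroup {A : Type*} [CStarAlgebra A]
    (U : OperatorSubsystem A) : AddCommGroup U := inferInstance

noncomputable instance OperatorSubsystem.instModule {A : Type*} [CStarAlgebra A]
    (U : OperatorSubsystem A) : Module ℂ U := inferInstance

instance OperatorSubsystem.instStarAddMonoid {A : Type*} [CStarAlgebra A]
    (U : OperatorSubsystem A) : StarAddMonoid U where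
  star_involutive a := Subtype.ext (star_star (a : A))
  star_add a b := Subtype.ext (star_add (a : A) (b : A))

instance OperatorSubsystem.instStarModule {A : Type*} [CStarAlgebra A]
    (U : OperatorSubsystem A) : StarModule ℂ U where
  star_smul c a := Subtype.ext (star_smul c (a : A))

/-- The operator system structure that a subsystem of `A` inherits: a matrix over `U` is positive
if it is positive in `M_p(A)`. -/
def OperatorSubsystem.toOperatorSystem {A : Type*} [CStarAlgebra A] (U : OperatorSubsystem A) :
    OperatorSystem U where
  cone p := {x | x.map (fun u : U => (u : A)) ∈ cstarCone A p}
  unit := ⟨1, U.one_mem'⟩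
  isHermitian {p x} hx := by
    have h := cstarCone_isHermitian hx
    ext i j
    exact congrFun (congrFun h i) j
  add_mem {p x y} hx hy := cstarCone_add_mem hx hy
  smul_mem {p x} r hr hx := cstarCone_smul_mem r hr hx
  proper {p x} hx hy := by
    have h := cstarCone_proper (x := x.map (fun u : U => (u : A))) hx hy
    ext i j
    exact congrFun (congrFun h i) j
  compress_mem {p q} α x hx := by
    have h := cstarCone_compress_mem α hx
    refine (congrArg (· ∈ cstarCone A _) ?_).mpr h
    ext i j
    change U.toSubmodule.subtype (∑ k, ∑ l, (star (α k i) * α l j) • x k l) = _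
    simp only [map_sum]
    rfl
  star_unit := Subtype.ext (star_one A)
  order_unit {p} x hx := by
    obtain ⟨r, hr, h⟩ := cstarCone_order_unit (x.map (fun u : U => (u : A))) (by
      ext i j
      exact congrArg Subtype.val (congrFun (congrFun hx i) j))
    refine ⟨r, hr, ?_⟩
    refine (congrArg (· ∈ cstarCone A _) ?_).mpr h
    ext i j
    by_cases hij : i = j <;> simp [Matrix.diagonal, hij]
  archimedean {p} x hx := by
    refine cstarCone_archimedean (x.map (fun u : U => (u : A))) fun ε hε => ?_
    refine (congrArg (· ∈ cstarCone A _) ?_).mpr (hx ε hε)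
    ext i j
    by_cases hij : i = j <;> simp [Matrix.diagonal, hij]

/-- The dual space of `V`, with the involution `f*(s) = conj (f (s*))`. -/
abbrev DualSpace (V : Type*) [AddCommGroup V] [Module ℂ V] : Type _ := WithConv (V →ₗ[ℂ] ℂ)

/-- For a matrix `G = [g_ij]` of functionals on `V`, the map `s ↦ [g_ij(s)]` into `M_p`. -/
def dualHat {V : Type*} [AddCommGroup V] [Module ℂ V] {p : ℕ}
    (G : Matrix (Fin p) (Fin p) (DualSpace V)) : V →ₗ[ℂ] CStarMatrix (Fin p) (Fin p) ℂ where
  toFun s := CStarMatrix.ofMatrix (Matrix.of fun i j => (G i j).ofConv s)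
  map_add' s t := by ext i j; simp
  map_smul' c s := by ext i j; simp

/-- The cone of `M_p(V^d)`: those `G` for which `s ↦ [g_ij(s)]` is completely positive. -/
def dualCone {V : Type*} [AddCommGroup V] [Module ℂ V] [StarAddMonoid V] [StarModule ℂ V]
    (S : OperatorSystem V) (p : ℕ) : Set (Matrix (Fin p) (Fin p) (DualSpace V)) :=
  {G | IsCompletelyPositive S
    (OperatorSystem.ofCStarAlgebra (CStarMatrix (Fin p) (Fin p) ℂ)) (dualHat G)}

/-- A faithful state on an operator system. -/
structure IsFaithfulState {V : Type*} [AddCommGroup V] [Module ℂ V] [StarAddMonoid V]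
    [StarModule ℂ V] (S : OperatorSystem V) (δ : V →ₗ[ℂ] ℂ) : Prop where
  map_unit : δ S.unit = 1
  nonneg : ∀ x : V, (Matrix.of fun _ _ => x) ∈ S.cone 1 → 0 ≤ δ x
  faithful : ∀ x : V, (Matrix.of fun _ _ => x) ∈ S.cone 1 → δ x = 0 → x = 0

/-- The functional `[s_ij] ↦ ∑ g_ij(s_ij)` on `M_p(V)`. -/
def dualPairing {V : Type*} [AddCommGroup V] [Module ℂ V] {p : ℕ}
    (G : Matrix (Fin p) (Fin p) (DualSpace V)) : Matrix (Fin p) (Fin p) V →ₗ[ℂ] ℂ where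
  toFun x := ∑ i, ∑ j, (G i j).ofConv (x i j)
  map_add' x y := by simp [Finset.sum_add_distrib]
  map_smul' c x := by simp [Finset.mul_sum]

theorem dualPairing_apply {V : Type*} [AddCommGroup V] [Module ℂ V] {p : ℕ}
    (G : Matrix (Fin p) (Fin p) (DualSpace V)) (x : Matrix (Fin p) (Fin p) V) :
    dualPairing G x = ∑ i, ∑ j, (G i j).ofConv (x i j) := rfl

theorem dualPairing_single {V : Type*} [AddCommGroup V] [Module ℂ V] {p : ℕ}
    (G : Matrix (Fin p) (Fin p) (DualSpace V)) (i j : Fin p) (v : V) :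
    dualPairing G (Matrix.single i j v) = (G i j).ofConv v := by
  rw [dualPairing_apply, Finset.sum_eq_single i, Finset.sum_eq_single j]
  · simp
  · intro b _ hb
    simp [hb.symm]
  · simp
  · intro b _ hb
    simp [hb.symm]
  · simp

theorem dualPairing_ext {V : Type*} [AddCommGroup V] [Module ℂ V] {p : ℕ}
    {G H : Matrix (Fin p) (Fin p) (DualSpace V)} (h : ∀ x, dualPairing G x = dualPairing H x) :
    G = H := by
  ext i j v
  rw [← dualPairing_single, h, dualPairing_single]

theorem dualPairing_conjTranspose {V : Type*} [AddCommGroup V] [Module ℂ V] [StarAddMonoid V]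
    [StarModule ℂ V] {p : ℕ} (G : Matrix (Fin p) (Fin p) (DualSpace V))
    (x : Matrix (Fin p) (Fin p) V) : dualPairing Gᴴ x = star (dualPairing G xᴴ) := by
  rw [dualPairing_apply, dualPairing_apply, Finset.sum_comm]
  simp [Matrix.conjTranspose_apply]

theorem OperatorSystem.unit_mem {V : Type*} [AddCommGroup V] [Module ℂ V] [StarAddMonoid V]
    [StarModule ℂ V] (S : OperatorSystem V) (p : ℕ) :
    (Matrix.diagonal fun _ => S.unit : Matrix (Fin p) (Fin p) V) ∈ S.cone p := by
  obtain ⟨r, hr, h⟩ := S.order_unit (p := p) (Matrix.diagonal fun _ => S.unit) (by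
    rw [Matrix.diagonal_conjTranspose]
    congr
    ext
    exact S.star_unit)
  have h2 := S.smul_mem (1 / (r + 1)) (by positivity) h
  convert h2 using 1
  nth_rewrite 3 [← one_smul ℂ (Matrix.diagonal fun _ => S.unit : Matrix (Fin p) (Fin p) V)]
  rw [← add_smul, smul_smul, ← Complex.ofReal_one, ← Complex.ofReal_add,
    ← Complex.ofReal_mul, one_div_mul_cancel (by positivity), Complex.ofReal_one, one_smul]

/-- A linear functional that vanishes on hermitian matrices vanishes. -/
theorem eq_zero_of_hermitian {V : Type*} [AddCommGroup V] [Module ℂ V] [StarAddMonoid V]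
    [StarModule ℂ V] {p : ℕ} (f : Matrix (Fin p) (Fin p) V →ₗ[ℂ] ℂ)
    (hf : ∀ x, xᴴ = x → f x = 0) : f = 0 := by
  ext x
  have h1 := hf (x + xᴴ) (by simp [add_comm])
  have h2 := hf (Complex.I • x + (Complex.I • x)ᴴ) (by simp [add_comm])
  rw [Matrix.conjTranspose_smul, Complex.star_def, Complex.conj_I, neg_smul, ← sub_eq_add_neg,
    ← smul_sub, map_smul, smul_eq_mul, mul_eq_zero, map_sub] at h2
  rw [map_add] at h1
  have h3 := h2.resolve_left Complex.I_ne_zero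
  rw [LinearMap.zero_apply]
  linear_combination (h1 + h3) / 2

theorem dualPairing_real {V : Type*} [AddCommGroup V] [Module ℂ V] [StarAddMonoid V]
    [StarModule ℂ V] (S : OperatorSystem V) {p : ℕ} {G : Matrix (Fin p) (Fin p) (DualSpace V)}
    (hG : ∀ x ∈ S.cone p, 0 ≤ dualPairing G x) (x : Matrix (Fin p) (Fin p) V) (hx : xᴴ = x) :
    star (dualPairing G x) = dualPairing G x := by
  obtain ⟨r, hr, h⟩ := S.order_unit x hx
  have h1 := (IsSelfAdjoint.of_nonneg (hG _ h)).star_eq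
  have h2 := (IsSelfAdjoint.of_nonneg (hG _ (S.smul_mem r hr (S.unit_mem p)))).star_eq
  rw [map_add, star_add, h2] at h1
  exact add_left_cancel h1

theorem isHermitian_of_dualPairing_nonneg {V : Type*} [AddCommGroup V] [Module ℂ V]
    [StarAddMonoid V] [StarModule ℂ V] (S : OperatorSystem V) {p : ℕ}
    {G : Matrix (Fin p) (Fin p) (DualSpace V)}
    (hG : ∀ x ∈ S.cone p, 0 ≤ dualPairing G x) : Gᴴ = G := by
  refine dualPairing_ext fun x => ?_
  have h := eq_zero_of_hermitian (dualPairing Gᴴ - dualPairing G) fun x hx => by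
    rw [LinearMap.sub_apply, dualPairing_conjTranspose, hx, dualPairing_real S hG x hx, sub_self]
  exact sub_eq_zero.mp (LinearMap.congr_fun h x)

theorem dualPairing_compress {V : Type*} [AddCommGroup V] [Module ℂ V] {p q : ℕ}
    (α : Matrix (Fin p) (Fin q) ℂ) (G : Matrix (Fin p) (Fin p) (DualSpace V))
    (x : Matrix (Fin q) (Fin q) V) :
    dualPairing (scalarCompress α G) x = dualPairing G (scalarCompress αᵀ x) := by
  have key : ∀ (f : Fin q → Fin q → Fin p → Fin p → ℂ),
      ∑ i, ∑ j, ∑ k, ∑ l, f i j k l = ∑ k, ∑ l, ∑ i, ∑ j, f i j k l := by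
    intro f
    calc _ = ∑ i, ∑ k, ∑ j, ∑ l, f i j k l := Finset.sum_congr rfl fun i _ => Finset.sum_comm
      _ = ∑ k, ∑ i, ∑ l, ∑ j, f i j k l := by
        rw [Finset.sum_comm]
        exact Finset.sum_congr rfl fun k _ => Finset.sum_congr rfl fun i _ => Finset.sum_comm
      _ = _ := Finset.sum_congr rfl fun k _ => Finset.sum_comm
  have hs : ∀ (s : Fin p → Fin p → DualSpace V) (v : V),
      (∑ k, ∑ l, s k l).ofConv v = ∑ k, ∑ l, (s k l).ofConv v := by
    intro s v
    have : ∀ (t : Fin p → DualSpace V) (v : V), (∑ k, t k).ofConv v = ∑ k, (t k).ofConv v := by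
      intro t v
      exact map_sum ((LinearMap.applyₗ v).comp (WithConv.linearEquiv ℂ (V →ₗ[ℂ] ℂ)).toLinearMap) t _
    rw [this]
    exact Finset.sum_congr rfl fun k _ => this _ _
  simp only [dualPairing_apply, scalarCompress, Matrix.of_apply, hs, map_sum]
  rw [key]
  simp [Matrix.transpose_apply]

open scoped MatrixOrder in
theorem posSemidef_iff_gram {n : Type*} [Fintype n] [DecidableEq n] (M : Matrix n n ℂ) :
    M.PosSemidef ↔ ∃ B : Matrix n n ℂ, M = Bᴴ * B :=
  Matrix.nonneg_iff_posSemidef.symm.trans CStarAlgebra.nonneg_iff_eq_star_mul_self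

/-- Positivity in `M_q(M_p)` through the quadratic form of the associated `qp × qp` matrix. -/
theorem mem_cstarCone_matrix_iff {q p : ℕ}
    (X : Matrix (Fin q) (Fin q) (CStarMatrix (Fin p) (Fin p) ℂ)) :
    X ∈ cstarCone (CStarMatrix (Fin p) (Fin p) ℂ) q ↔
      (Matrix.of fun (a b : Fin q × Fin p) => X a.1 b.1 a.2 b.2).PosSemidef := by
  rw [posSemidef_iff_gram]
  have ha : ∀ (Y : Matrix (Fin q) (Fin q) (CStarMatrix (Fin p) (Fin p) ℂ)) (a b : Fin q)
      (i j : Fin p), (Yᴴ * Y) a b i j = ∑ c, ∑ k, star (Y c a k i) * Y c b k j := by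
    intro Y a b i j
    let e : CStarMatrix (Fin p) (Fin p) ℂ →+ ℂ :=
      { toFun := fun M => M i j, map_zero' := rfl, map_add' := fun _ _ => rfl }
    exact map_sum e (fun c => star (Y c a) * Y c b) Finset.univ
  constructor
  · rintro ⟨Y, rfl⟩
    refine ⟨Matrix.of fun a b => Y a.1 b.1 a.2 b.2, ?_⟩
    ext a b
    rw [Matrix.of_apply, ha, Matrix.mul_apply, Fintype.sum_prod_type]
    rfl
  · rintro ⟨B, hB⟩
    refine ⟨Matrix.of fun a b => CStarMatrix.ofMatrix (Matrix.of fun i j => B (a, i) (b, j)), ?_⟩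
    ext a b i j
    rw [ha]
    have := congrFun (congrFun hB (a, i)) (b, j)
    rw [Matrix.of_apply, Matrix.mul_apply, Fintype.sum_prod_type] at this
    exact this

/-- `s ↦ [g_ij(s)]` is completely positive if and only if `[s_ij] ↦ ∑ g_ij(s_ij)` is positive. -/
theorem mem_dualCone_iff {V : Type*} [AddCommGroup V] [Module ℂ V] [StarAddMonoid V]
    [StarModule ℂ V] (S : OperatorSystem V) {p : ℕ} (G : Matrix (Fin p) (Fin p) (DualSpace V)) :
    G ∈ dualCone S p ↔ ∀ x ∈ S.cone p, 0 ≤ dualPairing G x := by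
  constructor
  · intro h x hx
    have h1 := (mem_cstarCone_matrix_iff _).mp (h p x hx)
    have h2 := h1.dotProduct_mulVec_nonneg fun a => if a.1 = a.2 then 1 else 0
    convert h2 using 1
    simp [dotProduct, Matrix.mulVec, Fintype.sum_prod_type, dualPairing_apply, dualHat, apply_ite]
  · intro h q x hx
    have hG := isHermitian_of_dualPairing_nonneg S h
    refine (mem_cstarCone_matrix_iff _).mpr (Matrix.PosSemidef.of_dotProduct_mulVec_nonneg ?_ ?_)
    · ext a b
      have h1 := S.isHermitian hx
      have h2 : G a.2 b.2 = star (G b.2 a.2) := (congrFun (congrFun hG a.2) b.2).symm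
      have h3 : x a.1 b.1 = star (x b.1 a.1) := (congrFun (congrFun h1 a.1) b.1).symm
      change star ((G b.2 a.2).ofConv (x b.1 a.1)) = (G a.2 b.2).ofConv (x a.1 b.1)
      rw [h2, h3, LinearMap.intrinsicStar_apply, star_star]
    · intro ξ
      convert h _ (S.compress_mem (Matrix.of fun a i => ξ (a, i)) hx) using 1
      simp only [dotProduct, Matrix.mulVec, Fintype.sum_prod_type, dualPairing_apply,
        scalarCompress, Matrix.of_apply, map_sum, map_smul, smul_eq_mul, Finset.mul_sum,
        Pi.star_apply]
      rw [Finset.sum_comm]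
      refine Finset.sum_congr rfl fun i _ => ?_
      rw [Finset.sum_comm (s := (Finset.univ : Finset (Fin p)))]
      refine Finset.sum_congr rfl fun a _ => ?_
      rw [Finset.sum_comm (s := (Finset.univ : Finset (Fin p)))]
      refine Finset.sum_congr rfl fun b _ => Finset.sum_congr rfl fun j _ => ?_
      change star (ξ (a, i)) * ((G i j).ofConv (x a b) * ξ (b, j)) = _
      ring

/-- Domination of a linear functional by a strictly positive one, over an Archimedean cone with
order unit in finite dimensions. -/
theorem exists_dominate_coord {d : ℕ} (C : Set (Fin d → ℝ)) (e : Fin d → ℝ)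
    (hadd : ∀ x ∈ C, ∀ y ∈ C, x + y ∈ C) (hsmul : ∀ r : ℝ, 0 ≤ r → ∀ x ∈ C, r • x ∈ C)
    (hunit : ∀ x, ∃ r : ℝ, 0 ≤ r ∧ r • e + x ∈ C)
    (harch : ∀ x, (∀ ε : ℝ, 0 < ε → ε • e + x ∈ C) → x ∈ C)
    (f g : (Fin d → ℝ) →ₗ[ℝ] ℝ) (hf : ∀ x ∈ C, x ≠ 0 → 0 < f x) :
    ∃ r : ℝ, 0 ≤ r ∧ ∀ x ∈ C, 0 ≤ r * f x + g x := by
  have he : e ∈ C := by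
    obtain ⟨r, hr, h⟩ := hunit e
    have := hsmul (1 / (r + 1)) (by positivity) _ h
    nth_rewrite 2 [← one_smul ℝ e] at this
    rwa [← add_smul, smul_smul, one_div_mul_cancel (by positivity), one_smul] at this
  have h0 : (0 : Fin d → ℝ) ∈ C := by simpa using hsmul 0 le_rfl e he
  obtain ⟨R, hR, hint⟩ : ∃ R : ℝ, 0 < R ∧ ∀ y : Fin d → ℝ, (R * ‖y‖) • e + y ∈ C := by
    choose r hr hr' using fun i : Fin d => hunit (Pi.single i 1)
    choose s hs hs' using fun i : Fin d => hunit (-Pi.single i 1)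
    refine ⟨∑ i, (r i + s i) + 1, by
      have := Finset.sum_nonneg fun i (_ : i ∈ Finset.univ) => add_nonneg (hr i) (hs i)
      linarith, fun y => ?_⟩
    have key : ∀ i, ((r i + s i) * ‖y‖) • e + Pi.single i (y i) ∈ C := by
      intro i
      have hy := norm_le_pi_norm y i
      rw [Real.norm_eq_abs] at hy
      rcases le_total 0 (y i) with hi | hi
      · rw [abs_of_nonneg hi] at hy
        have h1 := hsmul _ hi _ (hr' i)
        have h2 := hsmul ((r i + s i) * ‖y‖ - y i * r i) (by nlinarith [hr i, hs i, norm_nonneg y]) e he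
        convert hadd _ h2 _ h1 using 1
        rw [smul_add, smul_smul, ← add_assoc, ← add_smul, sub_add_cancel, ← Pi.single_smul]
        simp
      · rw [abs_of_nonpos hi] at hy
        have h1 := hsmul (-y i) (by linarith) _ (hs' i)
        have h2 := hsmul ((r i + s i) * ‖y‖ - (-y i) * s i) (by nlinarith [hr i, hs i, norm_nonneg y]) e he
        convert hadd _ h2 _ h1 using 1
        rw [smul_add, smul_smul, ← add_assoc, ← add_smul, sub_add_cancel, smul_neg, ← Pi.single_smul,
          ← Pi.single_neg]
        simp
    have h1 : ∑ i, (((r i + s i) * ‖y‖) • e + Pi.single i (y i)) ∈ C :=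
      Finset.sum_induction _ (· ∈ C) (fun a b ha hb => hadd a ha b hb) h0 fun i _ => key i
    rw [Finset.sum_add_distrib, Finset.univ_sum_single, ← Finset.sum_smul, ← Finset.sum_mul] at h1
    have h2 := hadd _ (hsmul ‖y‖ (norm_nonneg y) e he) _ h1
    convert h2 using 1
    rw [← add_assoc, ← add_smul]
    congr 2
    ring
  have hclosed : IsClosed C := by
    refine isClosed_of_closure_subset fun x hx => harch x fun ε hε => ?_
    obtain ⟨y, hy, hxy⟩ := Metric.mem_closure_iff.mp hx (ε / R) (by positivity)
    rw [dist_eq_norm, lt_div_iff₀ hR] at hxy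
    have h1 := hadd _ hy _ (hint (x - y))
    have h2 := hsmul (ε - R * ‖x - y‖) (by linarith) e he
    convert hadd _ h2 _ h1 using 1
    rw [sub_smul]
    abel
  have hfc : Continuous f := f.continuous_of_finiteDimensional
  have hgc : Continuous g := g.continuous_of_finiteDimensional
  let K : Set (Fin d → ℝ) := C ∩ Metric.sphere 0 1
  have hK : IsCompact K := (isCompact_sphere 0 1).inter_left hclosed
  have hKpos : ∀ x ∈ K, 0 < f x := fun x hx => hf x hx.1 fun h => by
    have := hx.2
    simp [h] at this
  obtain ⟨r, hr, hr'⟩ : ∃ r : ℝ, 0 ≤ r ∧ ∀ x ∈ K, -(g x) / f x ≤ r := by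
    have hcont : ContinuousOn (fun x => -(g x) / f x) K :=
      (hgc.neg.continuousOn).div hfc.continuousOn fun x hx => (hKpos x hx).ne'
    obtain ⟨b, hb⟩ := hK.bddAbove_image hcont
    exact ⟨max b 0, le_max_right _ _, fun x hx =>
      (hb (Set.mem_image_of_mem _ hx)).trans (le_max_left _ _)⟩
  refine ⟨r, hr, fun x hx => ?_⟩
  rcases eq_or_ne x 0 with rfl | hx0
  · simp
  have hn : 0 < ‖x‖ := norm_pos_iff.mpr hx0
  have hxK : ‖x‖⁻¹ • x ∈ K := ⟨hsmul _ (by positivity) _ hx, by simp [norm_smul, hn.ne']⟩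
  have h1 := hr' _ hxK
  rw [div_le_iff₀ (hKpos _ hxK), map_smul, map_smul, smul_eq_mul, smul_eq_mul] at h1
  have h2 : 0 ≤ ‖x‖⁻¹ * (r * f x + g x) := by linarith
  exact nonneg_of_mul_nonneg_right h2 (by positivity)

theorem IsFaithfulState.trace_pos {V : Type*} [AddCommGroup V] [Module ℂ V] [StarAddMonoid V]
    [StarModule ℂ V] {S : OperatorSystem V} {δ : V →ₗ[ℂ] ℂ} (hδ : IsFaithfulState S δ) {p : ℕ}
    {x : Matrix (Fin p) (Fin p) V} (hx : x ∈ S.cone p) :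
    0 ≤ ∑ i, δ (x i i) ∧ (x ≠ 0 → 0 < ∑ i, δ (x i i)) := by
  have hd : ∀ i, (Matrix.of fun _ _ => x i i) ∈ S.cone 1 := by
    intro i
    convert S.compress_mem (Matrix.of fun k (_ : Fin 1) => if k = i then 1 else 0) hx using 1
    ext a b
    simp [scalarCompress, apply_ite]
  have h0 : 0 ≤ ∑ i, δ (x i i) := Finset.sum_nonneg fun i _ => hδ.nonneg _ (hd i)
  refine ⟨h0, fun hne => lt_of_le_of_ne h0 fun h => hne ?_⟩
  have hz : ∀ i, x i i = 0 := fun i => hδ.faithful _ (hd i)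
    ((Finset.sum_eq_zero_iff_of_nonneg fun i _ => hδ.nonneg _ (hd i)).mp h.symm i
      (Finset.mem_univ i))
  ext i j
  rcases eq_or_ne i j with rfl | hij
  · exact hz i
  have hc : ∀ c : ℂ, (Matrix.of fun _ _ => c • x i j + star c • x j i :
      Matrix (Fin 1) (Fin 1) V) ∈ S.cone 1 := by
    intro c
    convert S.compress_mem
      (Matrix.of fun k (_ : Fin 1) => (if k = i then 1 else 0) + (if k = j then c else 0)) hx using 1
    ext a b
    have h1 : ∀ k l, (star ((if k = i then (1 : ℂ) else 0) + (if k = j then c else 0)) *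
        ((if l = i then 1 else 0) + (if l = j then c else 0))) • x k l =
        (if k = i then (if l = i then x k l else 0) else 0) +
        (if k = i then (if l = j then c • x k l else 0) else 0) +
        ((if k = j then (if l = i then star c • x k l else 0) else 0) +
        (if k = j then (if l = j then (star c * c) • x k l else 0) else 0)) := by
      intro k l
      by_cases h1 : k = i <;> by_cases h2 : k = j <;> by_cases h3 : l = i <;>
        by_cases h4 : l = j <;> simp [h1, h2, h3, h4, hij, hij.symm]
    simp only [scalarCompress, Matrix.of_apply, h1, Finset.sum_add_distrib]
    simp [hz]
  have hq : ∀ c : ℂ, c • x i j + star c • x j i = 0 := by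
    intro c
    have := S.proper (hc c) (by
      convert hc (-c) using 1
      ext a b
      simp [add_comm])
    exact congrFun (congrFun this 0) 0
  have e1 := hq 1
  have e2 := hq Complex.I
  simp only [one_smul, star_one] at e1
  rw [Complex.star_def, Complex.conj_I, neg_smul, ← sub_eq_add_neg, ← smul_sub] at e2
  have e3 := (smul_eq_zero.mp e2).resolve_left Complex.I_ne_zero
  have e4 : (2 : ℂ) • x i j = 0 := by
    rw [two_smul]
    calc x i j + x i j = (x i j + x j i) + (x i j - x j i) := by abel
      _ = 0 := by rw [e1, e3, add_zero]
  exact (smul_eq_zero.mp e4).resolve_left two_ne_zero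

theorem dualPairing_diagonal {V : Type*} [AddCommGroup V] [Module ℂ V] {p : ℕ}
    (δ : V →ₗ[ℂ] ℂ) (x : Matrix (Fin p) (Fin p) V) :
    dualPairing (Matrix.diagonal fun _ => WithConv.toConv δ) x = ∑ i, δ (x i i) := by
  rw [dualPairing_apply]
  refine Finset.sum_congr rfl fun i _ => ?_
  rw [Finset.sum_eq_single i]
  · simp
  · intro j _ hj
    simp [Matrix.diagonal_apply_ne' _ hj]
  · simp

theorem dualPairing_add {V : Type*} [AddCommGroup V] [Module ℂ V] {p : ℕ}
    (G H : Matrix (Fin p) (Fin p) (DualSpace V)) (x : Matrix (Fin p) (Fin p) V) :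
    dualPairing (G + H) x = dualPairing G x + dualPairing H x := by
  simp [dualPairing_apply, Finset.sum_add_distrib]

theorem dualPairing_smul {V : Type*} [AddCommGroup V] [Module ℂ V] {p : ℕ}
    (c : ℂ) (G : Matrix (Fin p) (Fin p) (DualSpace V)) (x : Matrix (Fin p) (Fin p) V) :
    dualPairing (c • G) x = c * dualPairing G x := by
  simp [dualPairing_apply, Finset.mul_sum]

theorem dualCone_order_unit {V : Type*} [AddCommGroup V] [Module ℂ V] [StarAddMonoid V]
    [StarModule ℂ V] [FiniteDimensional ℂ V] (S : OperatorSystem V) (δ : V →ₗ[ℂ] ℂ)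
    (hδ : IsFaithfulState S δ) {p : ℕ} (G : Matrix (Fin p) (Fin p) (DualSpace V)) (hG : Gᴴ = G) :
    ∃ r : ℝ, 0 ≤ r ∧
      (r : ℂ) • Matrix.diagonal (fun _ => WithConv.toConv δ) + G ∈ dualCone S p := by
  have : FiniteDimensional ℝ V := FiniteDimensional.complexToReal V
  let H : Submodule ℝ (Matrix (Fin p) (Fin p) V) :=
    { carrier := {x | xᴴ = x}
      add_mem' := fun {x y} hx hy => by
        rw [Set.mem_ofPred_eq] at *
        rw [Matrix.conjTranspose_add, hx, hy]
      zero_mem' := Matrix.conjTranspose_zero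
      smul_mem' := fun r x hx => by
        rw [Set.mem_ofPred_eq] at *
        rw [← Complex.coe_smul, Matrix.conjTranspose_smul, hx, Complex.star_def,
          Complex.conj_ofReal] }
  let b := (Module.finBasis ℝ H).equivFun
  let X : (Fin (Module.finrank ℝ H) → ℝ) →ₗ[ℝ] Matrix (Fin p) (Fin p) V :=
    H.subtype ∘ₗ b.symm.toLinearMap
  have hXh : ∀ c, (X c)ᴴ = X c := fun c => (b.symm c).2
  have hXs : ∀ x : Matrix (Fin p) (Fin p) V, xᴴ = x → ∃ c, X c = x := fun x hx =>
    ⟨b ⟨x, hx⟩, by simp [X]⟩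
  obtain ⟨e, he⟩ := hXs _ (S.isHermitian (S.unit_mem p))
  let D : Matrix (Fin p) (Fin p) (DualSpace V) := Matrix.diagonal fun _ => WithConv.toConv δ
  have hD : ∀ x, dualPairing D x = ∑ i, δ (x i i) := dualPairing_diagonal δ
  let f : Matrix (Fin p) (Fin p) (DualSpace V) → (Fin (Module.finrank ℝ H) → ℝ) →ₗ[ℝ] ℝ :=
    fun K => Complex.reLm ∘ₗ (dualPairing K).restrictScalars ℝ ∘ₗ X
  have hf : ∀ K c, f K c = (dualPairing K (X c)).re := fun _ _ => rfl
  obtain ⟨r, hr, h⟩ := exists_dominate_coord {c | X c ∈ S.cone p} e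
    (fun x hx y hy => by
      rw [Set.mem_ofPred_eq, map_add]
      exact S.add_mem hx hy)
    (fun r hr x hx => by
      rw [Set.mem_ofPred_eq, map_smul, ← Complex.coe_smul]
      exact S.smul_mem r hr hx)
    (fun x => by
      obtain ⟨r, hr, h⟩ := S.order_unit (X x) (hXh x)
      refine ⟨r, hr, ?_⟩
      rw [Set.mem_ofPred_eq, map_add, map_smul, he, ← Complex.coe_smul]
      exact h)
    (fun x hx => S.archimedean (X x) fun ε hε => by
      have := hx ε hε
      rw [Set.mem_ofPred_eq, map_add, map_smul, he, ← Complex.coe_smul] at this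
      exact this)
    (f D) (f G)
    (fun x hx hx0 => by
      rw [hf, hD]
      have h1 : X x ≠ 0 := fun h => hx0 (b.symm.injective (Subtype.ext (by simpa [X] using h)))
      exact (Complex.pos_iff.mp ((hδ.trace_pos hx).2 h1)).1)
  refine ⟨r, hr, (mem_dualCone_iff S _).mpr fun x hx => ?_⟩
  obtain ⟨c, rfl⟩ := hXs x (S.isHermitian hx)
  have h1 := h c hx
  rw [hf, hf] at h1
  rw [dualPairing_add, dualPairing_smul, Complex.nonneg_iff]
  have h2 : (dualPairing G (X c)).im = 0 := by
    have := dualPairing_conjTranspose G (X c)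
    rw [hG, hXh] at this
    exact Complex.conj_eq_iff_im.mp this.symm
  have h3 : (dualPairing D (X c)).im = 0 := by
    rw [hD]
    exact (Complex.nonneg_iff.mp (hδ.trace_pos hx).1).2.symm
  have h4 : (dualPairing (Matrix.diagonal fun _ => WithConv.toConv δ) (X c)).im = 0 := h3
  constructor
  · rw [Complex.add_re, Complex.re_ofReal_mul]
    exact h1
  · rw [Complex.add_im, Complex.im_ofReal_mul, h4, h2]
    simp

/-- The dual `S^d` of a finite-dimensional operator system `S`, as an operator system whose order
unit is a given faithful state `δ` of `S`. -/
def OperatorSystem.dual {V : Type*} [AddCommGroup V] [Module ℂ V] [StarAddMonoid V]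
    [StarModule ℂ V] [FiniteDimensional ℂ V] (S : OperatorSystem V) (δ : V →ₗ[ℂ] ℂ)
    (hδ : IsFaithfulState S δ) : OperatorSystem (DualSpace V) where
  cone := dualCone S
  unit := WithConv.toConv δ
  isHermitian {p G} hG := isHermitian_of_dualPairing_nonneg S ((mem_dualCone_iff S G).mp hG)
  add_mem {p G H} hG hH := by
    rw [mem_dualCone_iff] at *
    intro x hx
    rw [dualPairing_add]
    exact add_nonneg (hG x hx) (hH x hx)
  smul_mem {p G} r hr hG := by
    rw [mem_dualCone_iff] at *
    intro x hx
    rw [dualPairing_smul]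
    exact mul_nonneg (Complex.zero_le_real.mpr hr) (hG x hx)
  proper {p G} hG hG' := by
    rw [mem_dualCone_iff] at *
    have hneg : ∀ x, dualPairing (-G) x = -dualPairing G x := fun x => by
      simp [dualPairing_apply]
    have h0 : ∀ x ∈ S.cone p, dualPairing G x = 0 := fun x hx =>
      le_antisymm (by
        have := hG' x hx
        rw [hneg] at this
        exact neg_nonneg.mp this) (hG x hx)
    have h1 := eq_zero_of_hermitian (dualPairing G) fun x hx => by
      obtain ⟨r, hr, h⟩ := S.order_unit x hx
      have h2 := h0 _ h
      rw [map_add, h0 _ (S.smul_mem r hr (S.unit_mem p)), zero_add] at h2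
      exact h2
    refine dualPairing_ext fun x => ?_
    rw [h1]
    simp [dualPairing_apply]
  compress_mem {p q} α G hG := by
    rw [mem_dualCone_iff] at *
    intro x hx
    rw [dualPairing_compress]
    exact hG _ (S.compress_mem _ hx)
  star_unit := by
    have h := isHermitian_of_dualPairing_nonneg S (p := 1)
      (G := Matrix.diagonal fun _ => WithConv.toConv δ) fun x hx => by
        rw [dualPairing_diagonal]
        exact (hδ.trace_pos hx).1
    have := congrFun (congrFun h 0) 0
    simpa using this
  order_unit G hG := dualCone_order_unit S δ hδ G hG
  archimedean {p} G hG := by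
    simp only [mem_dualCone_iff] at *
    intro x hx
    have h0 := (hδ.trace_pos hx).1
    rw [Complex.nonneg_iff] at h0
    have h1 : ∀ ε : ℝ, 0 < ε → 0 ≤ ε * (∑ i, δ (x i i)).re + (dualPairing G x).re ∧
        (dualPairing G x).im = 0 := by
      intro ε hε
      have h2 := hG ε hε x hx
      rw [dualPairing_add, dualPairing_smul, dualPairing_diagonal, Complex.nonneg_iff,
        Complex.add_re, Complex.add_im, Complex.re_ofReal_mul, Complex.im_ofReal_mul, ← h0.2,
        mul_zero, zero_add] at h2
      exact ⟨h2.1, h2.2.symm⟩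
    rw [Complex.nonneg_iff]
    refine ⟨le_of_forall_pos_le_add fun η hη => ?_, (h1 1 one_pos).2.symm⟩
    have hpos : 0 < (∑ i, δ (x i i)).re + 1 := by linarith [h0.1]
    have h2 := (h1 (η / ((∑ i, δ (x i i)).re + 1)) (by positivity)).1
    have h3 : η / ((∑ i, δ (x i i)).re + 1) * (∑ i, δ (x i i)).re ≤ η := by
      rw [div_mul_eq_mul_div, div_le_iff₀ hpos]
      nlinarith
    linarith

/-- A unitary representation of a group on a nonzero complex Hilbert space. -/
structure UnitaryRepresentation (G : Type) [Group G] where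
  /-- the Hilbert space -/
  H : Type
  [normed : NormedAddCommGroup H]
  [inner : InnerProductSpace ℂ H]
  [complete : CompleteSpace H]
  [nontrivial : Nontrivial H]
  /-- the homomorphism into the unitary group of `H` -/
  π : G →* unitary (H →L[ℂ] H)

attribute [instance] UnitaryRepresentation.normed UnitaryRepresentation.inner
  UnitaryRepresentation.complete UnitaryRepresentation.nontrivial

/-- The C*-algebra of bounded families of operators, indexed by all unitary representations
of `G`. -/
abbrev BoundedFamilies (G : Type) [Group G] : Type _ :=
  lp (fun ρ : UnitaryRepresentation G => ρ.H →L[ℂ] ρ.H) ∞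

noncomputable instance BoundedFamilies.instCStarAlgebra (G : Type) [Group G] :
    CStarAlgebra (BoundedFamilies G) where

/-- The operator of `g` in the direct sum of all unitary representations of `G`. -/
noncomputable def universalUnitary {G : Type} [Group G] (g : G) : BoundedFamilies G :=
  ⟨fun ρ => (ρ.π g : ρ.H →L[ℂ] ρ.H), memℓp_infty ⟨1, by
    rintro _ ⟨ρ, rfl⟩
    exact (CStarRing.norm_coe_unitary (ρ.π g)).le⟩⟩

/-- The full group C*-algebra `C*(G)` of a discrete group `G`: the completion of the group algebra
in the norm `‖a‖ = sup ‖π(a)‖` over all unitary representations `π`, realized as the C*-algebra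
generated by `G` in the direct sum of all unitary representations. -/
def FullGroupCStarAlgebra (G : Type) [Group G] : Type _ :=
  (StarAlgebra.adjoin ℂ (Set.range (universalUnitary (G := G)))).topologicalClosure

noncomputable instance FullGroupCStarAlgebra.instCStarAlgebra (G : Type) [Group G] :
    CStarAlgebra (FullGroupCStarAlgebra G) :=
  haveI := StarSubalgebra.isClosed_topologicalClosure
    (StarAlgebra.adjoin ℂ (Set.range (universalUnitary (G := G))))
  StarSubalgebra.cstarAlgebra
    (StarAlgebra.adjoin ℂ (Set.range (universalUnitary (G := G)))).topologicalClosure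

/-- The canonical unitary of `C*(G)` that belongs to `g`. -/
noncomputable def FullGroupCStarAlgebra.of {G : Type} [Group G] (g : G) :
    FullGroupCStarAlgebra G :=
  (⟨universalUnitary g, StarSubalgebra.le_topologicalClosure _
    (StarAlgebra.subset_adjoin ℂ _ ⟨g, rfl⟩)⟩ :
    (StarAlgebra.adjoin ℂ (Set.range (universalUnitary (G := G)))).topologicalClosure)

/-- `w_1 = 1` and `w_2, …, w_n` are the universal unitaries that generate `C*(F_{n-1})`
(the indices are shifted: `freeUnitary n 0 = 1`). -/
noncomputable def freeUnitary (n : ℕ) (i : Fin n) :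
    FullGroupCStarAlgebra (FreeGroup (Fin (n - 1))) :=
  if h : (i : ℕ) = 0 then 1
  else FullGroupCStarAlgebra.of (FreeGroup.of ⟨i - 1, by omega⟩)

/-- The operator system `W_n` in `C*(F_{n-1})` spanned by the elements `w_i w_j*`. -/
noncomputable def OSW (n : ℕ) (hn : 2 ≤ n) :
    OperatorSubsystem (FullGroupCStarAlgebra (FreeGroup (Fin (n - 1)))) where
  toSubmodule := Submodule.span ℂ
    (Set.range fun ij : Fin n × Fin n => freeUnitary n ij.1 * star (freeUnitary n ij.2))
  one_mem' := Submodule.subset_span ⟨(⟨0, by omega⟩, ⟨0, by omega⟩), by simp [freeUnitary]⟩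
  star_mem' := by
    intro a ha
    change a ∈ Submodule.span ℂ _ at ha
    change star a ∈ Submodule.span ℂ _
    induction ha using Submodule.span_induction with
    | mem x hx =>
      obtain ⟨⟨i, j⟩, rfl⟩ := hx
      exact Submodule.subset_span ⟨(j, i), by simp⟩
    | zero => simp
    | add x y _ _ hx hy => rw [star_add]; exact Submodule.add_mem _ hx hy
    | smul c x _ hx => rw [star_smul]; exact Submodule.smul_mem _ _ hx

instance OSW.instFiniteDimensional (n : ℕ) (hn : 2 ≤ n) : FiniteDimensional ℂ (OSW n hn) :=
  FiniteDimensional.span_of_finite ℂ (Set.finite_range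
    fun ij : Fin n × Fin n => freeUnitary n ij.1 * star (freeUnitary n ij.2))

/-- The operator subsystem `E_n` of `M_n` of all matrices with constant diagonal. -/
def OSE (n : ℕ) : OperatorSubsystem (CStarMatrix (Fin n) (Fin n) ℂ) where
  carrier := {a | ∀ i j, a i i = a j j}
  add_mem' ha hb i j := by simp [ha i j, hb i j]
  zero_mem' i j := rfl
  smul_mem' c a ha i j := by simp [ha i j]
  one_mem' i j := by simp
  star_mem' ha i j := by
    rw [CStarMatrix.star_apply, CStarMatrix.star_apply, ha i j]

/-! The isomorphism is `θ(f) = [f(w_i w_j*)]`. Its values have constant diagonal because `w_i w_i* =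
1`, and it is injective because the elements `w_i w_j*` span `W_n`.

`θ` is completely positive because `[w_i w_j*]` is itself positive in `M_n(W_n)`
(`OSW.elem_mem_cone`): a completely positive map `s ↦ [g_kl(s)]` sends it to a positive matrix,
which is the image of `G` up to reordering indices (`dualToOSE_mem_cone`).

For the inverse, write a positive `x` in `M_p(E_n)` as a Gram matrix, `x_kl(i,j) = ⟨v_{k,i},
v_{l,j}⟩`. The constant diagonals say that `⟨v_{k,i}, v_{l,i}⟩` does not depend on `i`, so the
families `(v_{k,i})_k` for varying `i` have the same Gram matrix, and unitaries `T_i` carry the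
first family to the others. Since the group is free, `w_i ↦ T_i*` defines a representation `π`, and
the matrix coefficients `⟨v_{k,1}, π(·) v_{l,1}⟩` form a positive matrix over `W_n^d` that `θ` sends
to `x` (`exists_representation`, `exists_mem_dualCone`). Surjectivity follows because the positive
elements span `E_n`.

The faithful state is the canonical trace `a ↦ ⟨δ_1, λ(a) δ_1⟩`, with `λ` the left regular
representation. -/

/-! ### Gram matrices and unitaries -/

/-- Two families with the same Gram matrix in a finite-dimensional Hilbert space are related by
a unitary. -/
theorem exists_unitary_of_inner_eq {ι H : Type*} [Finite ι] [NormedAddCommGroup H]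
    [InnerProductSpace ℂ H] [FiniteDimensional ℂ H] [CompleteSpace H] (v w : ι → H)
    (h : ∀ i j, inner ℂ (v i) (v j) = inner ℂ (w i) (w j)) :
    ∃ U : unitary (H →L[ℂ] H), ∀ i, (U : H →L[ℂ] H) (v i) = w i := by
  have := Fintype.ofFinite ι
  let f := Fintype.linearCombination ℂ v
  let g := Fintype.linearCombination ℂ w
  -- The norm of a linear combination depends only on the Gram matrix, so `∑ c_i v_i ↦ ∑ c_i w_i` is
  -- well defined and isometric on the span of `v`.
  have hn : ∀ c, ‖f c‖ = ‖g c‖ := by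
    intro c
    rw [@norm_eq_sqrt_re_inner ℂ, @norm_eq_sqrt_re_inner ℂ]
    simp only [f, g, Fintype.linearCombination_apply, sum_inner, inner_sum, inner_smul_left,
      inner_smul_right, h]
  have hker : LinearMap.ker f ≤ LinearMap.ker g := by
    intro c hc
    rw [LinearMap.mem_ker] at *
    rw [← norm_eq_zero, ← hn, hc, norm_zero]
  let L : LinearMap.range f →ₗ[ℂ] H :=
    (LinearMap.ker f).liftQ g hker ∘ₗ f.quotKerEquivRange.symm.toLinearMap
  have hL : ∀ c, L ⟨f c, c, rfl⟩ = g c := by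
    intro c
    have : f.quotKerEquivRange.symm ⟨f c, c, rfl⟩ = (LinearMap.ker f).mkQ c := by
      rw [LinearEquiv.symm_apply_eq]
      rfl
    simp [L, this]
  let T : LinearMap.range f →ₗᵢ[ℂ] H :=
    { toLinearMap := L
      norm_map' := by
        rintro ⟨_, c, rfl⟩
        rw [hL]
        exact (hn c).symm }
  -- Finite dimension is used twice: the isometry of the span extends to all of `H`, and the
  -- extension is onto.
  let e : H ≃ₗᵢ[ℂ] H := T.extend.toLinearIsometryEquiv rfl
  refine ⟨Unitary.linearIsometryEquiv.symm e, fun i => ?_⟩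
  classical
  have hf : f (Pi.single i 1) = v i := by simp [f]
  have hg : g (Pi.single i 1) = w i := by simp [g]
  have h1 := T.extend_apply ⟨f (Pi.single i 1), _, rfl⟩
  have h2 := hL (Pi.single i 1)
  rw [hg] at h2
  change e (v i) = w i
  rw [← h2, ← hf]
  exact h1

/-! ### Representations of the full group C*-algebra -/

/-- The extension of a unitary representation of `G` to `C*(G)`. -/
def FullGroupCStarAlgebra.rep {G : Type} [Group G] (ρ : UnitaryRepresentation G) :
    FullGroupCStarAlgebra G →⋆ₐ[ℂ] (ρ.H →L[ℂ] ρ.H) where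
  -- `C*(G)` consists of families indexed by all representations, so the extension is a coordinate
  -- projection and no continuity argument is needed.
  toFun a := (Subtype.val a : BoundedFamilies G) ρ
  map_one' := rfl
  map_mul' _ _ := rfl
  map_zero' := rfl
  map_add' _ _ := rfl
  commutes' _ := rfl
  map_star' _ := rfl

theorem FullGroupCStarAlgebra.rep_of {G : Type} [Group G] (ρ : UnitaryRepresentation G) (g : G) :
    FullGroupCStarAlgebra.rep ρ (FullGroupCStarAlgebra.of g) = ρ.π g := rfl

theorem FullGroupCStarAlgebra.ext_rep {G : Type} [Group G] {a b : FullGroupCStarAlgebra G}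
    (h : ∀ ρ, FullGroupCStarAlgebra.rep ρ a = FullGroupCStarAlgebra.rep ρ b) : a = b :=
  Subtype.ext (Subtype.ext (funext h))

theorem FullGroupCStarAlgebra.of_one {G : Type} [Group G] :
    FullGroupCStarAlgebra.of (1 : G) = 1 :=
  ext_rep fun ρ => by rw [rep_of, map_one, map_one]; rfl

theorem FullGroupCStarAlgebra.of_mul {G : Type} [Group G] (g h : G) :
    FullGroupCStarAlgebra.of (g * h) = FullGroupCStarAlgebra.of g * FullGroupCStarAlgebra.of h :=
  ext_rep fun ρ => by rw [map_mul, rep_of, rep_of, rep_of, map_mul]; rfl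

theorem FullGroupCStarAlgebra.star_of {G : Type} [Group G] (g : G) :
    star (FullGroupCStarAlgebra.of g) = FullGroupCStarAlgebra.of g⁻¹ :=
  ext_rep fun ρ => by rw [map_star, rep_of, rep_of, map_inv]; rfl

/-! ### The left regular representation -/

/-- Composition with a permutation, as an isometry of `ℓ²`. -/
noncomputable def lpPermute {ι : Type*} (σ : Equiv.Perm ι) :
    lp (fun _ : ι => ℂ) 2 →ₗᵢ[ℂ] lp (fun _ : ι => ℂ) 2 where
  toFun f := ⟨fun i => f (σ i), memℓp_gen (((lp.memℓp f).summable (by simp)).comp_injective σ.injective)⟩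
  map_add' _ _ := rfl
  map_smul' _ _ := rfl
  norm_map' f := by
    rw [lp.norm_eq_tsum_rpow (by simp), lp.norm_eq_tsum_rpow (by simp)]
    congr 1
    exact σ.tsum_eq fun i => ‖f i‖ ^ (2 : ℝ≥0∞).toReal

/-- The left regular representation of `G` on `ℓ²(G)`. -/
noncomputable def leftRegular (G : Type) [Group G] : UnitaryRepresentation G where
  H := lp (fun _ : G => ℂ) 2
  nontrivial := by
    classical
    exact ⟨lp.single 2 1 1, 0, fun h => by simpa using congrArg (fun f => f (1 : G)) h⟩
  π := (Unitary.linearIsometryEquiv.symm.toMonoidHom).comp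
    -- `(λ(g) f)(h) = f(g⁻¹ h)`; the inverse makes `λ` a homomorphism rather than an
    -- antihomomorphism.
    { toFun := fun g =>
        { lpPermute (Equiv.mulLeft g⁻¹) with
          invFun := lpPermute (Equiv.mulLeft g)
          left_inv := fun f => lp.ext (funext fun h => congrArg f (inv_mul_cancel_left g h))
          right_inv := fun f => lp.ext (funext fun h => congrArg f (mul_inv_cancel_left g h)) }
      map_one' := LinearIsometryEquiv.ext fun f => lp.ext <| funext fun h =>
        congrArg f (show (1 : G)⁻¹ * h = h by simp)
      map_mul' := fun g k => LinearIsometryEquiv.ext fun f => lp.ext <| funext fun h =>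
        congrArg f (show (g * k)⁻¹ * h = k⁻¹ * (g⁻¹ * h) by simp [mul_assoc]) }

open scoped Classical in
/-- The vector `δ_1` of `ℓ²(G)`. -/
noncomputable def leftRegularUnit (G : Type) [Group G] : (leftRegular G).H :=
  (lp.single 2 1 1 : lp (fun _ : G => ℂ) 2)

theorem norm_leftRegularUnit (G : Type) [Group G] : ‖leftRegularUnit G‖ = 1 := by
  classical
  have h := lp.norm_single (E := fun _ : G => ℂ) (p := 2) (by simp) 1 1
  rw [norm_one] at h
  exact h

/-! ### Matrix coefficients and their positivity -/

/-- The matrix coefficient `a ↦ ⟨ξ, π(a) η⟩` on `C*(G)`. -/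
noncomputable def matrixCoefficient {G : Type} [Group G] (ρ : UnitaryRepresentation G)
    (ξ η : ρ.H) : FullGroupCStarAlgebra G →ₗ[ℂ] ℂ where
  toFun a := inner ℂ ξ (FullGroupCStarAlgebra.rep ρ a η)
  map_add' a b := by rw [map_add, add_apply, inner_add_right]
  map_smul' c a := by
    rw [map_smul, smul_apply, inner_smul_right]
    rfl

theorem matrixCoefficient_apply {G : Type} [Group G] (ρ : UnitaryRepresentation G)
    (ξ η : ρ.H) (a : FullGroupCStarAlgebra G) :
    matrixCoefficient ρ ξ η a = inner ℂ ξ (FullGroupCStarAlgebra.rep ρ a η) := rfl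

theorem matrixCoefficient_star_mul {G : Type} [Group G] (ρ : UnitaryRepresentation G)
    (ξ η : ρ.H) (a b : FullGroupCStarAlgebra G) :
    matrixCoefficient ρ ξ η (star a * b) =
      inner ℂ (FullGroupCStarAlgebra.rep ρ a ξ) (FullGroupCStarAlgebra.rep ρ b η) := by
  rw [matrixCoefficient_apply, map_mul, map_star, mul_apply_eq_comp,
    ContinuousLinearMap.star_eq_adjoint, ContinuousLinearMap.adjoint_inner_right]

/-- For `x = y* y` the double sum equals `∑_m ‖∑_k π(y_mk) ξ_k‖²`. This is the source of positive
elements of `M_p(W_n^d)` and, for `p = 1`, of the positivity of the trace. -/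
theorem sum_matrixCoefficient_nonneg {G : Type} [Group G] (ρ : UnitaryRepresentation G) {p : ℕ}
    (ξ : Fin p → ρ.H) {x : Matrix (Fin p) (Fin p) (FullGroupCStarAlgebra G)}
    (hx : x ∈ cstarCone (FullGroupCStarAlgebra G) p) :
    0 ≤ ∑ k, ∑ l, matrixCoefficient ρ (ξ k) (ξ l) (x k l) := by
  obtain ⟨y, rfl⟩ := hx
  have key : ∑ k, ∑ l, matrixCoefficient ρ (ξ k) (ξ l) ((yᴴ * y) k l) =
      ∑ m, inner ℂ (∑ k, FullGroupCStarAlgebra.rep ρ (y m k) (ξ k))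
        (∑ k, FullGroupCStarAlgebra.rep ρ (y m k) (ξ k)) := by
    simp only [Matrix.mul_apply, Matrix.conjTranspose_apply, map_sum, matrixCoefficient_star_mul,
      sum_inner, inner_sum]
    rw [Finset.sum_comm_cycle, Finset.sum_congr rfl]
    intro m _
    rw [Finset.sum_comm]
  rw [key]
  exact Finset.sum_nonneg fun m _ => by
    rw [inner_self_eq_norm_sq_to_K]
    exact pow_nonneg (Complex.zero_le_real.mpr (norm_nonneg (_ : ρ.H))) 2

theorem freeUnitary_eq_of (n : ℕ) (i : Fin n) :
    ∃ g, freeUnitary n i = FullGroupCStarAlgebra.of g := by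
  unfold freeUnitary
  split_ifs
  · exact ⟨1, FullGroupCStarAlgebra.of_one.symm⟩
  · exact ⟨_, rfl⟩

theorem freeUnitary_mul_star_self (n : ℕ) (i : Fin n) :
    freeUnitary n i * star (freeUnitary n i) = 1 := by
  obtain ⟨g, hg⟩ := freeUnitary_eq_of n i
  rw [hg, FullGroupCStarAlgebra.star_of, ← FullGroupCStarAlgebra.of_mul, mul_inv_cancel,
    FullGroupCStarAlgebra.of_one]

/-! ### The faithful state -/

/-- The vector `δ_1` of `ℓ²(G)` is separating for the linear span of `G`. -/
theorem eq_zero_of_leftRegular_eq_zero {G : Type} [Group G] {x : FullGroupCStarAlgebra G}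
    (hx : x ∈ Submodule.span ℂ (Set.range (FullGroupCStarAlgebra.of (G := G))))
    (h : FullGroupCStarAlgebra.rep (leftRegular G) x (leftRegularUnit G) = 0) : x = 0 := by
  classical
  obtain ⟨c, rfl⟩ := Finsupp.mem_span_range_iff_exists_finsupp.mp hx
  suffices c = 0 by simp [this]
  ext g
  let ev : (leftRegular G).H →ₗ[ℂ] ℂ :=
    { toFun := fun f => (show lp (fun _ : G => ℂ) 2 from f) g
      map_add' := fun _ _ => rfl
      map_smul' := fun _ _ => rfl }
  have h1 := congrArg ev h
  -- `λ(k) δ_1 = δ_k`, so the coordinate of `λ(x) δ_1` at `g` is the coefficient of `g` in `x`.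
  have h2 : ∀ k : G, ev (FullGroupCStarAlgebra.rep (leftRegular G) (FullGroupCStarAlgebra.of k)
      (leftRegularUnit G)) = if k = g then 1 else 0 := by
    intro k
    change (lp.single 2 1 1 : lp (fun _ : G => ℂ) 2) (k⁻¹ * g) = _
    rw [lp.single_apply, Pi.single_apply]
    simp [inv_mul_eq_one]
  rw [Finsupp.sum, map_sum, sum_apply, map_sum, map_zero] at h1
  simp only [map_smul, smul_apply, h2] at h1
  simpa using h1

/-- Elements of `W_n` are finite combinations of group elements. This is what makes the trace
faithful here, although it can fail to be faithful on the whole C*-algebra. -/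
theorem OSW_le_span_of (n : ℕ) (hn : 2 ≤ n) :
    (OSW n hn).toSubmodule ≤ Submodule.span ℂ (Set.range FullGroupCStarAlgebra.of) := by
  refine Submodule.span_mono ?_
  rintro _ ⟨⟨i, j⟩, rfl⟩
  obtain ⟨g, hg⟩ := freeUnitary_eq_of n i
  obtain ⟨h, hh⟩ := freeUnitary_eq_of n j
  exact ⟨g * h⁻¹, by
    simp only [hg, hh, FullGroupCStarAlgebra.star_of, FullGroupCStarAlgebra.of_mul]⟩

/-- The canonical trace of `C*(F_{n-1})` restricts to a faithful state of `W_n`. -/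
theorem exists_isFaithfulState_OSW (n : ℕ) (hn : 2 ≤ n) :
    ∃ δ : OSW n hn →ₗ[ℂ] ℂ, IsFaithfulState (OSW n hn).toOperatorSystem δ := by
  let G := FreeGroup (Fin (n - 1))
  let e := leftRegularUnit G
  refine ⟨(matrixCoefficient (leftRegular G) e e).comp (OSW n hn).toSubmodule.subtype,
    ?_, fun x hx => ?_, fun x hx h0 => ?_⟩
  · change inner ℂ e (FullGroupCStarAlgebra.rep (leftRegular G) 1 e) = 1
    rw [map_one, one_apply_eq_self, inner_self_eq_norm_sq_to_K,
      norm_leftRegularUnit]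
    simp
  · have h := sum_matrixCoefficient_nonneg (leftRegular G) (fun _ : Fin 1 => e) hx
    rw [Fin.sum_univ_one, Fin.sum_univ_one] at h
    exact h
  -- The factor `y` of `x = y* y` may lie outside the span of the group, so the separating property
  -- is applied to `x`: a zero trace gives `λ(y) δ_1 = 0`, hence `λ(x) δ_1 = λ(y)* λ(y) δ_1 = 0`.
  · obtain ⟨y, hy⟩ := hx
    have hxy : (x : FullGroupCStarAlgebra G) = star (y 0 0) * y 0 0 := by
      simpa [Matrix.mul_apply] using congrFun (congrFun hy 0) 0
    refine Subtype.ext (eq_zero_of_leftRegular_eq_zero (OSW_le_span_of n hn x.2) ?_)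
    change matrixCoefficient (leftRegular G) e e x = 0 at h0
    rw [hxy, matrixCoefficient_star_mul, inner_self_eq_zero] at h0
    change FullGroupCStarAlgebra.rep (leftRegular G) x e = 0
    rw [hxy, map_mul, mul_apply_eq_comp, h0, map_zero]

/-! ### The map `θ` and its complete positivity -/

/-- The spanning element `w_i w_j*` of `W_n`. -/
noncomputable def OSW.elem (n : ℕ) (hn : 2 ≤ n) (i j : Fin n) : OSW n hn :=
  ⟨freeUnitary n i * star (freeUnitary n j), Submodule.subset_span ⟨(i, j), rfl⟩⟩

theorem OSW.elem_self (n : ℕ) (hn : 2 ≤ n) (i j : Fin n) : elem n hn i i = elem n hn j j :=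
  Subtype.ext ((freeUnitary_mul_star_self n i).trans (freeUnitary_mul_star_self n j).symm)

theorem OSW.hom_ext {n : ℕ} {hn : 2 ≤ n} {f g : OSW n hn →ₗ[ℂ] ℂ}
    (h : ∀ i j, f (elem n hn i j) = g (elem n hn i j)) : f = g := by
  ext ⟨x, hx⟩
  change x ∈ Submodule.span ℂ _ at hx
  induction hx using Submodule.span_induction with
  | mem x hx =>
    obtain ⟨⟨i, j⟩, rfl⟩ := hx
    exact h i j
  | zero => exact (map_zero f).trans (map_zero g).symm
  | add x y hx hy h1 h2 =>
    exact (map_add f ⟨x, hx⟩ ⟨y, hy⟩).trans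
      ((congrArg₂ (· + ·) h1 h2).trans (map_add g ⟨x, hx⟩ ⟨y, hy⟩).symm)
  | smul c x hx h1 =>
    exact (map_smul f c ⟨x, hx⟩).trans
      ((congrArg (c • ·) h1).trans (map_smul g c ⟨x, hx⟩).symm)

/-- The matrix is `z* z` for the row `z = (w_1*, …, w_n*)`. Evaluating functionals on this one
positive matrix yields `θ`. -/
theorem OSW.elem_mem_cone (n : ℕ) (hn : 2 ≤ n) :
    Matrix.of (elem n hn) ∈ (OSW n hn).toOperatorSystem.cone n := by
  change (Matrix.of (elem n hn)).map _ ∈ cstarCone _ n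
  convert cstarCone_gram_mem (Matrix.of fun (_ : Fin 1) j => star (freeUnitary n j)) using 1
  ext i j
  simp [Matrix.mul_apply, elem]

/-- The map `f ↦ [f(w_i w_j*)]` from `W_n^d` to `E_n`. -/
noncomputable def dualToOSE (n : ℕ) (hn : 2 ≤ n) : DualSpace (OSW n hn) →ₗ[ℂ] OSE n where
  toFun f := ⟨CStarMatrix.ofMatrix (Matrix.of fun i j => f.ofConv (OSW.elem n hn i j)),
    fun i j => congrArg f.ofConv (OSW.elem_self n hn i j)⟩
  map_add' _ _ := rfl
  map_smul' _ _ := rfl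

theorem dualToOSE_apply (n : ℕ) (hn : 2 ≤ n) (f : DualSpace (OSW n hn)) (i j : Fin n) :
    (dualToOSE n hn f : CStarMatrix (Fin n) (Fin n) ℂ) i j = f.ofConv (OSW.elem n hn i j) := rfl

theorem dualToOSE_injective (n : ℕ) (hn : 2 ≤ n) : Function.Injective (dualToOSE n hn) := by
  intro f g h
  refine WithConv.ofConv_injective (OSW.hom_ext fun i j => ?_)
  rw [← dualToOSE_apply, h, dualToOSE_apply]

theorem mem_OSE_cone_iff {n p : ℕ} (x : Matrix (Fin p) (Fin p) (OSE n)) :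
    x ∈ (OSE n).toOperatorSystem.cone p ↔
      (Matrix.of fun a b : Fin p × Fin n =>
        (x a.1 b.1 : CStarMatrix (Fin n) (Fin n) ℂ) a.2 b.2).PosSemidef :=
  mem_cstarCone_matrix_iff _

theorem dualToOSE_mem_cone {n : ℕ} (hn : 2 ≤ n) {p : ℕ}
    {G : Matrix (Fin p) (Fin p) (DualSpace (OSW n hn))}
    (hG : G ∈ dualCone (OSW n hn).toOperatorSystem p) :
    G.map (dualToOSE n hn) ∈ (OSE n).toOperatorSystem.cone p := by
  rw [mem_OSE_cone_iff]
  -- Complete positivity at level `n` gives a positive element of `M_n(M_p)`; `Prod.swap` turns it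
  -- into one of `M_p(M_n)`.
  exact ((mem_cstarCone_matrix_iff _).mp (hG n _ (OSW.elem_mem_cone n hn))).submatrix Prod.swap

/-! ### Lifting positive matrices over `E_n` -/

/-- Gram vectors `v_{k,i}` whose inner products for fixed `i` do not depend on `i` are moved into
each other by a unitary representation of the free group. -/
theorem exists_representation {n p : ℕ} (hn : 2 ≤ n) {H : Type} [NormedAddCommGroup H]
    [InnerProductSpace ℂ H] [FiniteDimensional ℂ H] [CompleteSpace H] [Nontrivial H]
    (v : Fin p → Fin n → H)
    (h : ∀ k l i j, inner ℂ (v k i) (v l i) = inner ℂ (v k j) (v l j)) :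
    ∃ (ρ : UnitaryRepresentation (FreeGroup (Fin (n - 1)))) (ξ : Fin p → ρ.H), ∀ k l i j,
      matrixCoefficient ρ (ξ k) (ξ l) (freeUnitary n i * star (freeUnitary n j)) =
        inner ℂ (v k i) (v l j) := by
  let z : Fin n := ⟨0, by omega⟩
  choose T hT using fun i => exists_unitary_of_inner_eq (fun k => v k z) (fun k => v k i)
    fun k l => h k l z i
  let ρ : UnitaryRepresentation (FreeGroup (Fin (n - 1))) :=
    { H := H
      -- The coefficient at `w_i w_j*` is `⟨π(w_i)* ξ_k, π(w_j)* ξ_l⟩`, so `π(w_i)*` has to be `T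
      -- i`; hence the inverse. Generator `m` belongs to index `m + 1`, since index `0` carries the
      -- unit.
      π := FreeGroup.lift fun m => (T ⟨m + 1, by omega⟩)⁻¹ }
  have key : ∀ k i, FullGroupCStarAlgebra.rep ρ (star (freeUnitary n i)) (v k z) = v k i := by
    intro k i
    by_cases hi : (i : ℕ) = 0
    · have : i = z := Fin.ext hi
      rw [freeUnitary, dif_pos hi, star_one, map_one, this]
      rfl
    · have h1 : ρ.π (FreeGroup.of ⟨i - 1, by omega⟩)⁻¹ = T i := by
        rw [map_inv, FreeGroup.lift_apply_of, inv_inv]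
        congr 1
        exact Fin.ext (Nat.succ_pred_eq_of_ne_zero hi)
      rw [freeUnitary, dif_neg hi, FullGroupCStarAlgebra.star_of, FullGroupCStarAlgebra.rep_of, h1]
      exact hT i k
  refine ⟨ρ, fun k => v k z, fun k l i j => ?_⟩
  rw [← star_star (freeUnitary n i), matrixCoefficient_star_mul, key, key]

/-- Given injectivity of `θ`, this is complete positivity of the inverse; the case `p = 1` also
yields surjectivity. -/
theorem exists_mem_dualCone {n p : ℕ} (hn : 2 ≤ n)
    {x : Matrix (Fin p) (Fin p) (OSE n)} (hx : x ∈ (OSE n).toOperatorSystem.cone p) :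
    ∃ G ∈ dualCone (OSW n hn).toOperatorSystem p, G.map (dualToOSE n hn) = x := by
  -- For `p = 0` the Hilbert space below would be zero, which is not allowed in a
  -- `UnitaryRepresentation`.
  rcases Nat.eq_zero_or_pos p with rfl | hp
  · exact ⟨0, (mem_dualCone_iff _ _).mpr fun x _ => by simp [dualPairing_apply],
      Subsingleton.elim _ _⟩
  have : Nonempty (Fin p × Fin n) := ⟨⟨0, hp⟩, ⟨0, by omega⟩⟩
  obtain ⟨B, hB⟩ := (posSemidef_iff_gram _).mp ((mem_OSE_cone_iff x).mp hx)
  -- The vectors are the columns of `B`, where `Bᴴ * B` is the matrix of `x`.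
  let v : Fin p → Fin n → EuclideanSpace ℂ (Fin p × Fin n) := fun k i =>
    WithLp.toLp 2 fun c => B c (k, i)
  have hv : ∀ k l i j, inner ℂ (v k i) (v l j) =
      (x k l : CStarMatrix (Fin n) (Fin n) ℂ) i j := by
    intro k l i j
    have := congrFun (congrFun hB (k, i)) (l, j)
    rw [Matrix.of_apply, Matrix.mul_apply] at this
    rw [this, PiLp.inner_apply]
    refine Finset.sum_congr rfl fun c _ => ?_
    rw [RCLike.inner_apply, mul_comm]
    rfl
  -- The hypothesis on the Gram vectors is exactly that every entry `x k l` has constant diagonal.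
  obtain ⟨ρ, ξ, hρ⟩ := exists_representation hn v fun k l i j => by
    rw [hv, hv]
    exact (x k l).2 i j
  refine ⟨Matrix.of fun k l => WithConv.toConv
    ((matrixCoefficient ρ (ξ k) (ξ l)).comp (OSW n hn).toSubmodule.subtype), ?_, ?_⟩
  · rw [mem_dualCone_iff]
    intro s hs
    exact sum_matrixCoefficient_nonneg ρ ξ hs
  · ext1 k l
    refine Subtype.ext (CStarMatrix.ext fun i j => ?_)
    exact (hρ k l i j).trans (hv k l i j)

/-! ### Bijectivity and conclusion -/

/-- The range is a subspace containing all positive elements. A hermitian `x` is the difference of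
the positive elements `r • 1 + x` and `r • 1`, and hermitian elements span. -/
theorem dualToOSE_surjective (n : ℕ) (hn : 2 ≤ n) : Function.Surjective (dualToOSE n hn) := by
  have hpos : ∀ x : OSE n, (Matrix.of fun _ _ => x) ∈ (OSE n).toOperatorSystem.cone 1 →
      x ∈ LinearMap.range (dualToOSE n hn) := by
    intro x hx
    obtain ⟨G, -, hG⟩ := exists_mem_dualCone hn hx
    exact ⟨G 0 0, congrFun (congrFun hG 0) 0⟩
  have hunit : (OSE n).toOperatorSystem.unit ∈ LinearMap.range (dualToOSE n hn) := by
    refine hpos _ ?_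
    convert (OSE n).toOperatorSystem.unit_mem 1
    ext a b
    simp [Subsingleton.elim a b]
  have hherm : ∀ x : OSE n, star x = x → x ∈ LinearMap.range (dualToOSE n hn) := by
    intro x hx
    obtain ⟨r, -, h⟩ := (OSE n).toOperatorSystem.order_unit (p := 1) (Matrix.of fun _ _ => x)
      (by ext1 a b; exact hx)
    have h1 : (r : ℂ) • (OSE n).toOperatorSystem.unit + x ∈ LinearMap.range (dualToOSE n hn) := by
      refine hpos _ ?_
      convert h using 1
      ext a b
      simp [Subsingleton.elim a b]
    simpa using Submodule.sub_mem _ h1 (Submodule.smul_mem _ (r : ℂ) hunit)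
  intro x
  have h1 := hherm (x + star x) (by rw [star_add, star_star, add_comm])
  have h2 := hherm (Complex.I • (x - star x)) (by
    rw [star_smul, star_sub, star_star, Complex.star_def, Complex.conj_I, neg_smul, ← smul_neg,
      neg_sub])
  -- `x = ½ ((x + x*) - i · i(x - x*))`, with both `x + x*` and `i(x - x*)` hermitian.
  have h3 := Submodule.smul_mem _ (1 / 2 : ℂ)
    (Submodule.sub_mem _ h1 (Submodule.smul_mem _ Complex.I h2))
  convert h3 using 1
  rw [smul_smul, Complex.I_mul_I, neg_one_smul, sub_neg_eq_add, add_add_sub_cancel, ← two_smul ℂ x,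
    smul_smul]
  norm_num

/-- The linear isomorphism `f ↦ [f(w_i w_j*)]` of `W_n^d` onto `E_n`. -/
noncomputable def dualEquivOSE (n : ℕ) (hn : 2 ≤ n) : DualSpace (OSW n hn) ≃ₗ[ℂ] OSE n :=
  LinearEquiv.ofBijective (dualToOSE n hn) ⟨dualToOSE_injective n hn, dualToOSE_surjective n hn⟩

/-- The cones of the dual do not depend on `δ`, which only provides the order unit, so the same `θ`
serves every faithful state. -/
theorem mainTheorem11 (n : ℕ) (hn : 2 ≤ n) :
    (∃ δ : OSW n hn →ₗ[ℂ] ℂ, IsFaithfulState (OSW n hn).toOperatorSystem δ) ∧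
    ∀ (δ : OSW n hn →ₗ[ℂ] ℂ) (hδ : IsFaithfulState (OSW n hn).toOperatorSystem δ),
      CompletelyOrderIsomorphic ((OSW n hn).toOperatorSystem.dual δ hδ) (OSE n).toOperatorSystem := by
  refine ⟨exists_isFaithfulState_OSW n hn, fun δ hδ =>
    ⟨dualEquivOSE n hn, fun p G hG => dualToOSE_mem_cone hn hG, fun p x hx => ?_⟩⟩
  -- By injectivity the positive lift `G` is the only preimage, so it is the image of the given
  -- matrix under the inverse.
  obtain ⟨G, hG, rfl⟩ := exists_mem_dualCone hn hx
  convert show G ∈ ((OSW n hn).toOperatorSystem.dual δ hδ).cone p from hG using 1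
  ext1 k l
  exact (dualEquivOSE n hn).symm_apply_apply (G k l)
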